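/- For a graph $H$ and an integer $t \ge 0$, the blowup $H[t]$ is the graph obtained from $H$ by replacing every vertex by an independent set of $t$ vertices and every edge by a complete bipartite graph $K_{t,t}$ between the corresponding sets. A labeled copy of $H$ in a graph $G$ is an injective map $V(H)\to V(G)$ sending edges of $H$ to edges of $G$. All graphs are finite and simple, $\log$ is the natural logarithm, and "$G$ contains $H[t]$" means that $G$ has a (not necessarily induced) subgraph isomorphic to $H[t]$. Theorem. Let $0 < \eta < 1/e$, let $H$ be a graph on $k$ vertices with at least one edge, and set $$\lambda = \frac{\eta^{\,1-1/|E(H)|}}{5\log(1/\eta)}.$$ Then there is an integer $N$, depending only on $\eta$ and $H$, such that for every $n \ge N$ the following holds: if $G$ is a graph on $n$ vertices containing at least $\eta n^k$ labeled copies of $H$, then $G$ contains the blowup $H[t]$ with $t = \lceil \lambda \log n\rceil$. -/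

import Mathlib

/-- The `t`-blowup `H[t]` of a graph `H`: every vertex `w` of `H` is replaced by an independent set
`{w} × Fin t` of order `t`, and every edge of `H` by a complete bipartite graph `K_{t,t}` between
the corresponding parts. -/
def SimpleGraph.blowup {W : Type*} (H : SimpleGraph W) (t : ℕ) : SimpleGraph (W × Fin t) where
  Adj x y := H.Adj x.1 y.1
  symm := ⟨fun _ _ h => H.adj_symm h⟩
  loopless := ⟨fun _ h => H.ne_of_adj h rfl⟩

/-! The exponent 1 - 1/m, with m = |E(H)|, comes from rooting the copies of H at the sparsest of m
edges. Regularity supplies disjoint, pairwise ε-uniform sets A_w of linear size whose product (the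
box) has a density τ ≥ (1-δ)η of copies of H (`exists_uniform_box`). The counting lemma
`prod_pairDensity_mul_card_le` bounds the product of the m pair densities by (1+δ)τ, so some edge ab
of H has pair density at most D = ((1+δ)τ)^(1/m). Weight a pair (u, v) in A_a × A_b by the
proportion of the box that extends it to a copy. The mean weight is τ and non-edges weigh 0, so the
edges between A_a and A_b have mean weight at least τ/D, which is at least about η^(1-1/m).

A weighted Kővári–Sós–Turán argument (`exists_weighted_biclique`) then finds K_{M,M}, M = ⌈(2/5) log
n / log(1/η)⌉, between A_a and A_b with a perfect matching of weight at least (3/5)(τ/D)M. The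
matching edges are M partial copies. The other vertices v of H are added one by one
(`IsPartialBlowup.insert`): sort the candidates in A_v by the set of partial copies they extend with
nonzero weight. There are only 2^M classes, few compared with n, so one class is large and heavy.
All its members are joined correctly to the same partial copies, and only a factor 1-δ of the weight
is lost.

A completed copy has weight at most 1, so at least (1-δ)^k (3/5)(τ/D)M of them survive. Since 3/5 ·
2/5 > 1/5, there is room for all the error terms. -/

section
open Finset Fintype
open scoped Classical

/-! ### Averaging over boxes and injective choices -/

/-- Resampling one coordinate does not change an average over a box. -/
theorem card_mul_sum_piFinset {W V : Type*} [Fintype W] (A : W → Finset V) (a : W)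
    (g : (W → V) → ℝ) :
    (#(A a) : ℝ) * ∑ x ∈ piFinset A, g x =
      ∑ x ∈ piFinset A, ∑ u ∈ A a, g (Function.update x a u) := by
  rw [← sum_product', mul_comm, ← nsmul_eq_mul', ]
  have : ∑ x ∈ piFinset A ×ˢ A a, g x.1 = #(A a) • ∑ x ∈ piFinset A, g x := by
    rw [sum_product]; simp [sum_const, smul_sum]
  rw [← this]
  refine sum_nbij' (fun p => (Function.update p.1 a p.2, p.1 a))
    (fun p => (Function.update p.1 a p.2, p.1 a)) ?_ ?_ ?_ ?_ ?_
  · rintro ⟨x, u⟩ h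
    simp only [mem_product, mem_piFinset] at h ⊢
    refine ⟨fun w => ?_, h.1 a⟩
    by_cases hw : w = a
    · subst hw; simpa using h.2
    · simpa [hw] using h.1 w
  · rintro ⟨x, u⟩ h
    simp only [mem_product, mem_piFinset] at h ⊢
    refine ⟨fun w => ?_, h.1 a⟩
    by_cases hw : w = a
    · subst hw; simpa using h.2
    · simpa [hw] using h.1 w
  · rintro ⟨x, u⟩ -; simp
  · rintro ⟨x, u⟩ -; simp
  · rintro ⟨x, u⟩ -; simp

/-- Assigning distinct elements of `C` to the indices in `I` with at least the average weight. -/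
theorem exists_injOn_sum_ge {ι V : Type*} (I : Finset ι) (C : Finset V) (φ : ι → V → ℝ) (s : ℝ)
    (hC : C.Nonempty) (hIC : #I ≤ #C) (h : s * #C ≤ ∑ v ∈ C, ∑ i ∈ I, φ i v) :
    ∃ z : ι → V, (∀ i, z i ∈ C) ∧ Set.InjOn z I ∧ s ≤ ∑ i ∈ I, φ i (z i) := by
  have hpos : 0 < #C := hC.card_pos
  have : NeZero #C := ⟨hpos.ne'⟩
  -- Place `I` injectively in the cyclic group `ZMod #C` and average over translates: every
  -- translate is injective, and each index meets every element of `C` once.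
  let e : ZMod #C ≃ C :=
    Fintype.equivOfCardEq (by rw [ZMod.card, Fintype.card_coe])
  obtain ⟨ι₀, -, hι₀⟩ := I.finite_toSet.exists_injOn_of_encard_le
    (t := (Set.univ : Set (ZMod #C))) (by
      rw [Set.encard_coe_eq_coe_finsetCard, Set.encard_univ, ENat.card_eq_coe_fintype_card,
        ZMod.card]
      exact_mod_cast hIC)
  have key : ∑ t : ZMod #C, ∑ i ∈ I, φ i (e (ι₀ i + t)) = ∑ v ∈ C, ∑ i ∈ I, φ i v := by
    rw [sum_comm, sum_comm (s := C)]
    refine sum_congr rfl fun i _ => ?_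
    rw [← sum_coe_sort C, ← e.sum_comp]
    exact Equiv.sum_comp (Equiv.addLeft (ι₀ i)) fun t => φ i (e t)
  obtain ⟨t, -, ht⟩ := exists_le_of_sum_le (s := (univ : Finset (ZMod #C)))
    (f := fun _ => s) (g := fun t => ∑ i ∈ I, φ i (e (ι₀ i + t))) univ_nonempty
    (by rw [key]; simpa [mul_comm] using h)
  refine ⟨fun i => e (ι₀ i + t), fun i => (e _).2, fun i hi j hj hij => hι₀ hi hj ?_, ht⟩
  exact add_right_cancel (e.injective (Subtype.ext hij))

/-- The number of non-injective `M`-tuples of elements of `A`. -/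
theorem card_not_injective_le {V : Type*} (M : ℕ) (A : Finset V) :
    (#{y ∈ piFinset fun _ : Fin M => A | ¬ Function.Injective y} : ℝ) * #A ≤
      (M : ℝ) ^ 2 * (#A : ℝ) ^ M := by
  have hsub : {y ∈ piFinset fun _ : Fin M => A | ¬ Function.Injective y} ⊆
      (univ : Finset (Fin M)).offDiag.biUnion fun p =>
        {y ∈ piFinset fun _ : Fin M => A | y p.1 = y p.2} := by
    intro y hy
    simp only [mem_filter, Function.Injective, not_forall] at hy
    obtain ⟨hy, i, j, hij, hne⟩ := hy
    exact mem_biUnion.2 ⟨(i, j), by simpa using hne, by simp [hy, hij]⟩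
  have hone : ∀ p ∈ (univ : Finset (Fin M)).offDiag,
      #{y ∈ piFinset fun _ : Fin M => A | y p.1 = y p.2} * #A ≤ #A ^ M := by
    rintro ⟨i, j⟩ hp
    have hne : i ≠ j := by simpa using hp
    calc _ = #({y ∈ piFinset fun _ : Fin M => A | y i = y j} ×ˢ A) := (card_product _ _).symm
      _ ≤ #(piFinset fun _ : Fin M => A) := by
        -- Coordinate `i` repeats coordinate `j`, so overwriting it by `u` loses no information.
        refine card_le_card_of_injOn (fun q => Function.update q.1 i q.2) ?_ ?_
        · rintro ⟨y, u⟩ h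
          simp only [coe_product, Set.mem_prod, mem_coe, mem_filter, mem_piFinset] at h ⊢
          intro w
          by_cases hw : w = i
          · subst hw; simpa using h.2
          · simpa [hw] using h.1.1 w
        · rintro ⟨y, u⟩ h ⟨y', u'⟩ h' heq
          simp only [coe_product, Set.mem_prod, mem_coe, mem_filter, mem_piFinset] at h h'
          have hu : u = u' := by simpa using congrFun heq i
          have hw : ∀ w, w ≠ i → y w = y' w := fun w hw => by simpa [hw] using congrFun heq w
          refine Prod.ext (funext fun w => ?_) hu
          by_cases hwi : w = i
          · subst hwi
            exact h.1.2.trans ((hw j hne.symm).trans h'.1.2.symm)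
          · exact hw w hwi
      _ = #A ^ M := by simp
  have : #{y ∈ piFinset fun _ : Fin M => A | ¬ Function.Injective y} * #A ≤ M ^ 2 * #A ^ M := by
    calc _ ≤ (∑ p ∈ (univ : Finset (Fin M)).offDiag,
          #{y ∈ piFinset fun _ : Fin M => A | y p.1 = y p.2}) * #A :=
        Nat.mul_le_mul_right _ ((card_le_card hsub).trans card_biUnion_le)
      _ ≤ #(univ : Finset (Fin M)).offDiag * #A ^ M := by
        rw [sum_mul, ← smul_eq_mul (#(univ : Finset (Fin M)).offDiag)]
        exact sum_le_card_nsmul _ _ _ hone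
      _ ≤ M ^ 2 * #A ^ M := by
        refine Nat.mul_le_mul_right _ ?_
        rw [offDiag_card, sq]; simp
  exact_mod_cast this

/-! ### Weighted bicliques -/

/-- A weighted Kővári–Sós–Turán theorem: `K_{M,M}` with a perfect matching of large weight. -/
theorem exists_weighted_biclique {V : Type*} (R : V → V → Prop) (A B : Finset V)
    (φ : V → V → ℝ) (τ d : ℝ) (M : ℕ) (hφ₁ : ∀ u v, φ u v ≤ 1)
    (hφR : ∀ u v, ¬ R u v → φ u v = 0) (hτ₀ : 0 < τ) (hd₀ : 0 < d)
    (hτ : τ * #A * #B ≤ ∑ v ∈ B, ∑ u ∈ A, φ u v)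
    (hd : ∑ v ∈ B, (#{u ∈ A | R u v} : ℝ) ≤ d * #A * #B) (hM : 1 ≤ M)
    (hMA : (M : ℝ) ^ 2 ≤ τ / d / 30 * (τ / 3) ^ M * #A)
    (hMB : (M : ℝ) ≤ τ / d / 30 * (τ / 3) ^ M * #B) :
    ∃ y z : Fin M → V, (∀ i, y i ∈ A) ∧ (∀ i, z i ∈ B) ∧ y.Injective ∧ z.Injective ∧
      (∀ i j, R (y i) (z j)) ∧ 3 / 5 * (τ / d) * M ≤ ∑ i, φ (y i) (z i) := by
  set r := τ / d with hr
  have hr₀ : 0 < r := by positivity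
  have hM₀ : (1 : ℝ) ≤ M := by exact_mod_cast hM
  have hA : (0 : ℝ) < #A := by
    by_contra h
    have : (#A : ℝ) = 0 := le_antisymm (not_lt.1 h) (by positivity)
    rw [this] at hMA; nlinarith
  have hB : (0 : ℝ) < #B := by
    by_contra h
    have : (#B : ℝ) = 0 := le_antisymm (not_lt.1 h) (by positivity)
    rw [this] at hMB; nlinarith
  set N : V → Finset V := fun v => {u ∈ A | R u v} with hN
  set w : V → ℝ := fun v => ∑ u ∈ A, φ u v with hw
  have hwN : ∀ v, w v = ∑ u ∈ N v, φ u v := fun v => by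
    rw [hw, hN, sum_filter]
    exact sum_congr rfl fun u _ => by split_ifs with h <;> simp [hφR, h]
  have hwle : ∀ v, w v ≤ #(N v) := fun v => by
    rw [hwN, ← nsmul_one #(N v)]
    exact sum_le_card_nsmul _ _ _ fun u _ => hφ₁ u v
  -- Outside `Z` the weight per edge is below 2/3 of the mean `r`, so those vertices carry at most
  -- 2/3 of the total. At least a third is left for `Z`, and weight is at most degree.
  set Z : Finset V := {v ∈ B | 2 / 3 * r * #(N v) ≤ w v} with hZ
  have hZdeg : τ / 3 * #A * #B ≤ ∑ v ∈ Z, (#(N v) : ℝ) := by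
    have h1 : ∑ v ∈ B, w v ≤ ∑ v ∈ Z, (#(N v) : ℝ) + ∑ v ∈ B, 2 / 3 * r * #(N v) := by
      rw [hZ, sum_filter, ← sum_add_distrib]
      refine sum_le_sum fun v _ => ?_
      split_ifs with h
      · have := hwle v
        have : 0 ≤ 2 / 3 * r * #(N v) := by positivity
        linarith
      · linarith
    have h2 : ∑ v ∈ B, 2 / 3 * r * (#(N v) : ℝ) ≤ 2 / 3 * (τ * #A * #B) := by
      rw [← mul_sum]
      calc 2 / 3 * r * ∑ v ∈ B, (#(N v) : ℝ) ≤ 2 / 3 * r * (d * #A * #B) := by gcongr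
        _ = 2 / 3 * (τ * #A * #B) := by rw [hr]; field_simp
    linarith
  have hpow : (τ / 3) ^ M * (#A : ℝ) ^ M * #B ≤ ∑ v ∈ Z, (#(N v) : ℝ) ^ M := by
    obtain ⟨K, rfl⟩ : ∃ K, M = K + 1 := ⟨M - 1, by omega⟩
    have hZ0 : 0 < #Z := by
      rw [card_pos]; by_contra h
      rw [not_nonempty_iff_eq_empty.1 h, Finset.sum_empty] at hZdeg
      have : 0 < τ / 3 * #A * #B := by positivity
      linarith
    have hZ0' : (0 : ℝ) < #Z := by exact_mod_cast hZ0
    have hZB : (#Z : ℝ) ≤ #B := by exact_mod_cast card_le_card (filter_subset _ _)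
    refine le_trans ?_ (pow_sum_div_card_le_sum_pow (fun v _ => by positivity) K)
    rw [le_div_iff₀ (by positivity)]
    calc (τ / 3) ^ (K + 1) * (#A : ℝ) ^ (K + 1) * #B * (#Z : ℝ) ^ K
        ≤ (τ / 3) ^ (K + 1) * (#A : ℝ) ^ (K + 1) * #B * (#B : ℝ) ^ K := by gcongr
      _ = (τ / 3 * #A * #B) ^ (K + 1) := by ring
      _ ≤ _ := by gcongr
  -- With the target subtracted, one large sum of `g` yields both many common neighbours `v` (as `g
  -- ≤ M`) and an average weight above the target. The surplus per edge on `Z` is 2/3 - 3/5 = 1/15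
  -- of `r`.
  set g : (Fin M → V) → V → ℝ := fun y v => ∑ i, φ (y i) v - 3 / 5 * r * M with hg
  have hgle : ∀ y v, g y v ≤ M := fun y v => by
    have : ∑ i, φ (y i) v ≤ M := by
      simpa using sum_le_card_nsmul (univ : Finset (Fin M)) _ 1 fun i _ => hφ₁ (y i) v
    have : 0 ≤ 3 / 5 * r * M := by positivity
    simp only [hg]; linarith
  have hgsum : ∀ v ∈ Z, r / 15 * M * (#(N v) : ℝ) ^ M ≤
      ∑ y ∈ piFinset fun _ : Fin M => N v, g y v := by
    intro v hv
    have hv' := (mem_filter.1 hv).2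
    obtain ⟨K, rfl⟩ : ∃ K, M = K + 1 := ⟨M - 1, by omega⟩
    have : ∑ y ∈ piFinset fun _ : Fin (K + 1) => N v, ∑ i, φ (y i) v =
        (K + 1 : ℕ) * (#(N v) : ℝ) ^ K * w v := by
      rw [sum_comm]
      simp_rw [sum_piFinset_apply (fun u => φ u v) (N v)]
      simp [hwN]; ring
    simp only [hg, sum_sub_distrib, this]
    simp only [sum_const, Fintype.card_piFinset_const, nsmul_eq_mul, Nat.cast_pow]
    have : ((K + 1 : ℕ) : ℝ) * (#(N v) : ℝ) ^ K * (2 / 3 * r * #(N v)) ≤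
      (K + 1 : ℕ) * (#(N v) : ℝ) ^ K * w v := by gcongr
    refine le_trans (le_of_eq ?_) (sub_le_sub_right this _)
    push_cast; ring
  set Zy : (Fin M → V) → Finset V := fun y => {v ∈ Z | ∀ i, R (y i) v} with hZy
  have htotal : r / 15 * M * ((τ / 3) ^ M * (#A : ℝ) ^ M * #B) ≤
      ∑ y ∈ piFinset fun _ : Fin M => A, ∑ v ∈ Zy y, g y v := by
    calc _ ≤ r / 15 * M * ∑ v ∈ Z, (#(N v) : ℝ) ^ M := by gcongr
      _ ≤ ∑ v ∈ Z, ∑ y ∈ piFinset fun _ : Fin M => N v, g y v := by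
        rw [mul_sum]; exact sum_le_sum hgsum
      _ = _ := by
        refine sum_comm' fun v y => ?_
        simp only [hN, hZy, mem_piFinset, mem_filter]
        exact ⟨fun h => ⟨⟨h.1, fun i => (h.2 i).2⟩, fun i => (h.2 i).1⟩,
          fun h => ⟨h.1.1, fun i => ⟨h.2 i, h.1.2 i⟩⟩⟩
  have hZyle : ∀ y, ∑ v ∈ Zy y, g y v ≤ #(Zy y) * M := fun y => by
    simpa using sum_le_card_nsmul (Zy y) _ (M : ℝ) fun v _ => hgle y v
  have hZyB : ∀ y, (#(Zy y) : ℝ) ≤ #B := fun y => by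
    exact_mod_cast card_le_card ((filter_subset _ _).trans (filter_subset _ _))
  -- Half of the 1/15 surplus; the other half pays for the non-injective tuples.
  set κ := r / 30 * (τ / 3) ^ M with hκ
  have hκ₀ : 0 < κ := by positivity
  have hbad : ∑ y ∈ piFinset fun _ : Fin M => A with ¬ y.Injective, ∑ v ∈ Zy y, g y v ≤
      κ * M * (#A : ℝ) ^ M * #B := by
    have h1 : ∑ y ∈ piFinset fun _ : Fin M => A with ¬ y.Injective, ∑ v ∈ Zy y, g y v ≤
        (#{y ∈ piFinset fun _ : Fin M => A | ¬ Function.Injective y} : ℝ) * (#B * M) := by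
      rw [← nsmul_eq_mul]
      exact sum_le_card_nsmul _ _ _ fun y _ => (hZyle y).trans (mul_le_mul_of_nonneg_right (hZyB y) (by positivity))
    have h2 : (#{y ∈ piFinset fun _ : Fin M => A | ¬ Function.Injective y} : ℝ) ≤
        κ * (#A : ℝ) ^ M := by
      have h3 := card_not_injective_le M A
      refine le_of_mul_le_mul_right (h3.trans ?_) hA
      calc (M : ℝ) ^ 2 * (#A : ℝ) ^ M ≤ κ * #A * (#A : ℝ) ^ M := by gcongr
        _ = _ := by ring
    calc _ ≤ _ := h1
      _ ≤ κ * (#A : ℝ) ^ M * (#B * M) := by gcongr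
      _ = _ := by ring
  have hgood : ∑ y ∈ piFinset fun _ : Fin M => A with y.Injective, κ * M * #B ≤
      ∑ y ∈ piFinset fun _ : Fin M => A with y.Injective, ∑ v ∈ Zy y, g y v := by
    have h1 := sum_filter_add_sum_filter_not (piFinset fun _ : Fin M => A) (fun y => y.Injective)
      fun y => ∑ v ∈ Zy y, g y v
    have h2 : ∑ y ∈ piFinset fun _ : Fin M => A with y.Injective, κ * M * #B ≤
        κ * M * (#A : ℝ) ^ M * #B := by
      rw [sum_const, nsmul_eq_mul]
      have : (#{y ∈ piFinset fun _ : Fin M => A | y.Injective} : ℝ) ≤ (#A : ℝ) ^ M := by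
        exact_mod_cast (card_le_card (filter_subset _ _)).trans (by simp)
      calc _ ≤ (#A : ℝ) ^ M * (κ * M * #B) := by gcongr
        _ = _ := by ring
    have h3 : r / 15 * M * ((τ / 3) ^ M * (#A : ℝ) ^ M * #B) =
      2 * (κ * M * (#A : ℝ) ^ M * #B) := by rw [hκ]; ring
    linarith
  have hne : {y ∈ piFinset fun _ : Fin M => A | y.Injective}.Nonempty := by
    by_contra h
    rw [not_nonempty_iff_eq_empty] at h
    have h1 := sum_filter_add_sum_filter_not (piFinset fun _ : Fin M => A) (fun y => y.Injective)
      fun y => ∑ v ∈ Zy y, g y v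
    rw [h, Finset.sum_empty] at h1
    have h3 : r / 15 * M * ((τ / 3) ^ M * (#A : ℝ) ^ M * #B) =
      2 * (κ * M * (#A : ℝ) ^ M * #B) := by rw [hκ]; ring
    have : 0 < κ * M * (#A : ℝ) ^ M * #B := by positivity
    linarith
  obtain ⟨y, hy, hgy⟩ := exists_le_of_sum_le hne hgood
  obtain ⟨hyA, hyinj⟩ := mem_filter.1 hy
  have hcard : (M : ℝ) ≤ #(Zy y) := by
    refine hMB.trans (le_of_mul_le_mul_right (?_ : κ * #B * M ≤ #(Zy y) * M) (by linarith))
    linarith [hZyle y]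
  have hcard' : M ≤ #(Zy y) := by exact_mod_cast hcard
  obtain ⟨z, hzC, hzinj, hz⟩ := exists_injOn_sum_ge (univ : Finset (Fin M)) (Zy y)
    (fun i v => φ (y i) v) (3 / 5 * r * M) (card_pos.1 (by omega)) (by simpa using hcard') (by
      have : 0 ≤ κ * M * #B := by positivity
      simp only [hg, sum_sub_distrib, sum_const, nsmul_eq_mul] at hgy
      linarith)
  have hzm := fun i => mem_filter.1 (hzC i)
  exact ⟨y, z, fun i => mem_piFinset.1 hyA i, fun i => (mem_filter.1 (hzm i).1).1, hyinj,
    fun i j h => hzinj (by simp) (by simp) h, fun i j => (hzm j).2 i, hz⟩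

/-! ### Growing the biclique into a blowup -/

/-- The proportion of points of the box `A` that, after being overwritten by `x` on `S`, lie
in `F`. -/
noncomputable def extensionDensity {W V : Type*} [Fintype W] (A : W → Finset V)
    (F : Finset (W → V)) (S : Finset W) (x : W → V) : ℝ :=
  #{y ∈ piFinset A | S.piecewise x y ∈ F} / #(piFinset A)

section extensionDensity
variable {W V : Type*} [Fintype W] (A : W → Finset V) (F : Finset (W → V)) (S : Finset W)
  (x : W → V)

theorem extensionDensity_nonneg : 0 ≤ extensionDensity A F S x := by
  unfold extensionDensity; positivity

theorem extensionDensity_le_one : extensionDensity A F S x ≤ 1 :=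
  div_le_one_of_le₀ (by exact_mod_cast card_le_card (filter_subset _ _)) (by positivity)

variable {A F S x}

theorem exists_mem_of_extensionDensity_ne_zero (h : extensionDensity A F S x ≠ 0) :
    ∃ y ∈ F, ∀ w ∈ S, y w = x w := by
  have : {y ∈ piFinset A | S.piecewise x y ∈ F}.Nonempty := by
    by_contra h'
    exact h (by simp [extensionDensity, not_nonempty_iff_eq_empty.1 h'])
  obtain ⟨y, hy⟩ := this
  exact ⟨_, (mem_filter.1 hy).2, fun w hw => by simp [hw]⟩

theorem extensionDensity_empty (hF : F ⊆ piFinset A) :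
    extensionDensity A F ∅ x = #F / #(piFinset A) := by
  simp only [extensionDensity, piecewise_empty]
  rw [filter_mem_eq_inter, inter_eq_right.2 hF]

/-- Law of total probability: a uniformly random value in coordinate `v` preserves the expected
density of extensions. -/
theorem sum_extensionDensity_insert {v : W} (hv : v ∉ S) :
    ∑ u ∈ A v, extensionDensity A F (insert v S) (Function.update x v u) =
      #(A v) * extensionDensity A F S x := by
  have h := card_mul_sum_piFinset A v fun y => if S.piecewise x y ∈ F then (1 : ℝ) else 0
  have hpw : ∀ (y : W → V) (u : V), (insert v S).piecewise (Function.update x v u) y =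
      S.piecewise x (Function.update y v u) := by
    intro y u
    funext w
    by_cases hw : w = v
    · subst hw; simp [hv]
    · by_cases hS : w ∈ S <;> simp [hw, hS]
  rw [sum_comm] at h
  simp only [extensionDensity, hpw, ← sum_div, ← mul_div_assoc]
  congr 1
  simpa using h.symm

end extensionDensity

/-- The tuples `X i`, `i ∈ B`, restricted to `S`, form a blowup of `H[S]` inside the box `A`. -/
def IsPartialBlowup {ι W V : Type*} (H : SimpleGraph W) (G : SimpleGraph V) (A : W → Finset V)
    (S : Finset W) (X : ι → W → V) (B : Finset ι) : Prop :=
  (∀ w ∈ S, ∀ i ∈ B, X i w ∈ A w) ∧ (∀ w ∈ S, Set.InjOn (fun i => X i w) B) ∧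
    ∀ a ∈ S, ∀ b ∈ S, H.Adj a b → ∀ i ∈ B, ∀ j ∈ B, G.Adj (X i a) (X j b)

/-- Pigeonhole over the at most 2^M sets of tuples that a candidate for `v` can extend. Within one
class every candidate is compatible with every tuple of `B'`, so distinct candidates may be assigned
freely, and a cyclic assignment keeps the average weight. -/
theorem IsPartialBlowup.insert {W V : Type*} [Fintype W] {H : SimpleGraph W}
    {G : SimpleGraph V} {A : W → Finset V} {F : Finset (W → V)}
    (hF : ∀ x ∈ F, ∀ a b, H.Adj a b → G.Adj (x a) (x b)) {M : ℕ} {S : Finset W}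
    {X : Fin M → W → V} {B : Finset (Fin M)} (hX : IsPartialBlowup H G A S X B) {s δ : ℝ}
    (hs : s ≤ ∑ i ∈ B, extensionDensity A F S (X i)) (hs₀ : 0 < s) (hδ₁ : δ < 1) {v : W}
    (hv : v ∉ S) (hM : (M : ℝ) ^ 2 * 2 ^ M ≤ δ * s * #(A v)) :
    ∃ (X' : Fin M → W → V) (B' : Finset (Fin M)), IsPartialBlowup H G A (insert v S) X' B' ∧
      (1 - δ) * s ≤ ∑ i ∈ B', extensionDensity A F (insert v S) (X' i) := by
  set f : Fin M → V → ℝ := fun i u =>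
    extensionDensity A F (Insert.insert v S) (Function.update (X i) v u) with hf
  have hM₀ : (0 : ℝ) < M := by
    rcases Nat.eq_zero_or_pos M with rfl | h
    · have : ∑ i ∈ B, extensionDensity A F S (X i) = 0 := sum_eq_zero fun i _ => i.elim0
      linarith
    · exact_mod_cast h
  set type : V → Finset (Fin M) := fun u => {i ∈ B | f i u ≠ 0} with htype
  set g : V → ℝ := fun u => ∑ i ∈ type u, f i u - (1 - δ) * s with hg
  have hgle : ∀ u, g u ≤ (M : ℝ) - (1 - δ) * s := fun u => by
    have h1 : ∑ i ∈ type u, f i u ≤ #(type u) := by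
      simpa using sum_le_card_nsmul (type u) (fun i => f i u) 1
        fun i _ => extensionDensity_le_one _ _ _ _
    have h2 : (#(type u) : ℝ) ≤ M := by
      exact_mod_cast (card_le_univ _).trans_eq (Fintype.card_fin M)
    simp only [hg]; linarith
  have hsum : ∑ u ∈ A v, ∑ i ∈ type u, f i u =
      #(A v) * ∑ i ∈ B, extensionDensity A F S (X i) := by
    simp only [htype, sum_filter_ne_zero]
    rw [sum_comm, mul_sum]
    exact sum_congr rfl fun i _ => sum_extensionDensity_insert hv
  have hgsum : δ * s * #(A v) ≤ ∑ u ∈ A v, g u := by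
    simp only [hg, sum_sub_distrib, hsum, sum_const, nsmul_eq_mul]
    have : (#(A v) : ℝ) * s ≤ #(A v) * ∑ i ∈ B, extensionDensity A F S (X i) := by gcongr
    linarith
  -- The surplus `M ^ 2` serves twice: as `g ≤ M`, it forces at least `M` candidates of one type,
  -- and its positivity makes their average reach `(1 - δ) * s`.
  obtain ⟨B', hB', hT⟩ : ∃ B' ∈ (univ : Finset (Finset (Fin M))), (M : ℝ) ^ 2 ≤
      ∑ u ∈ A v with type u = B', g u := by
    refine exists_le_of_sum_le univ_nonempty ?_
    rw [Finset.sum_fiberwise]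
    simpa [mul_comm] using hM.trans hgsum
  set T := {u ∈ A v | type u = B'} with hTdef
  have hgle' : ∀ u ∈ T, g u ≤ (M : ℝ) := fun u _ => by
    have : 0 < (1 - δ) * s := mul_pos (by linarith) hs₀
    linarith [hgle u]
  have hTcard : M ≤ #T := by
    have h1 : ∑ u ∈ T, g u ≤ #T * M := by
      simpa using sum_le_card_nsmul T g (M : ℝ) hgle'
    have : (M : ℝ) ≤ #T := le_of_mul_le_mul_right (by nlinarith) hM₀
    exact_mod_cast this
  have hTB : ∀ u ∈ T, type u = B' := fun u hu => (mem_filter.1 hu).2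
  have hM' : 0 < M := by exact_mod_cast hM₀
  obtain ⟨z, hzT, hzinj, hz⟩ := exists_injOn_sum_ge B' T f ((1 - δ) * s)
    (card_pos.1 (by omega)) (((card_le_univ _).trans_eq (Fintype.card_fin M)).trans hTcard) (by
      have h1 : ∑ u ∈ T, g u = ∑ u ∈ T, ∑ i ∈ B', f i u - #T * ((1 - δ) * s) := by
        rw [← nsmul_eq_mul, ← sum_const, ← sum_sub_distrib]
        exact sum_congr rfl fun u hu => by rw [← hTB u hu]
      have : (0 : ℝ) ≤ (M : ℝ) ^ 2 := by positivity
      linarith)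
  have hne : ∀ i ∈ B', ∀ j, f i (z j) ≠ 0 := fun i hi j => by
    have := hTB _ (hzT j) ▸ hi
    exact (mem_filter.1 this).2
  have hsub : ∀ i ∈ B', i ∈ B := fun i hi => by
    have := hTB _ (hzT i) ▸ hi
    exact (mem_filter.1 this).1
  have hnv : ∀ w ∈ S, w ≠ v := fun w hw h => hv (h ▸ hw)
  -- Nonzero density is witnessed by a genuine copy through `X i` and `z j`, whence adjacency even
  -- for `i ≠ j`.
  have hadj : ∀ a ∈ S, H.Adj a v → ∀ i ∈ B', ∀ j, G.Adj (X i a) (z j) := by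
    intro a ha hav i hi j
    obtain ⟨y, hyF, hy⟩ := exists_mem_of_extensionDensity_ne_zero (hne i hi j)
    have h1 := hy a (by simp [ha])
    have h2 := hy v (by simp)
    rw [Function.update_of_ne (hnv a ha)] at h1
    rw [Function.update_self] at h2
    exact h1 ▸ h2 ▸ hF y hyF a v hav
  refine ⟨fun i => Function.update (X i) v (z i), B', ⟨?_, ?_, ?_⟩, hz⟩
  · intro w hw i hi
    rcases mem_insert.1 hw with rfl | hw
    · simpa using (mem_filter.1 (hzT i)).1
    · simpa [hnv w hw] using hX.1 w hw i (hsub i hi)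
  · intro w hw i hi j hj hij
    rcases mem_insert.1 hw with rfl | hw
    · exact hzinj hi hj (by simpa using hij)
    · exact hX.2.1 w hw (hsub i hi) (hsub j hj) (by simpa [hnv w hw] using hij)
  · intro a ha b hb hab i hi j hj
    rcases mem_insert.1 ha with rfl | ha' <;> rcases mem_insert.1 hb with rfl | hb'
    · exact (H.irrefl hab).elim
    · simpa [hnv b hb'] using (hadj b hb' hab.symm j hj i).symm
    · simpa [hnv a ha'] using hadj a ha' hab i hi j
    · simpa [hnv a ha', hnv b hb'] using hX.2.2 a ha' b hb' hab i (hsub i hi) j (hsub j hj)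

theorem IsPartialBlowup.extend {W V : Type*} [Fintype W] {H : SimpleGraph W}
    {G : SimpleGraph V} {A : W → Finset V} {F : Finset (W → V)}
    (hF : ∀ x ∈ F, ∀ a b, H.Adj a b → G.Adj (x a) (x b)) {M : ℕ} {S : Finset W}
    {X : Fin M → W → V} {B : Finset (Fin M)} (hX : IsPartialBlowup H G A S X B) {s δ : ℝ}
    (hs : s ≤ ∑ i ∈ B, extensionDensity A F S (X i)) (hs₀ : 0 < s) (hδ : 0 < δ) (hδ₁ : δ < 1)
    (hM : ∀ v, (M : ℝ) ^ 2 * 2 ^ M ≤ δ * ((1 - δ) ^ Fintype.card W * s) * #(A v)) :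
    ∃ (X' : Fin M → W → V) (B' : Finset (Fin M)), IsPartialBlowup H G A univ X' B' ∧
      (1 - δ) ^ Fintype.card W * s ≤ #B' := by
  have h1δ : 0 < 1 - δ := by linarith
  have hle : ∀ j, j ≤ Fintype.card W → (1 - δ) ^ Fintype.card W * s ≤ (1 - δ) ^ j * s :=
    fun j hj => mul_le_mul_of_nonneg_right
      (pow_le_pow_of_le_one h1δ.le (by linarith) hj) hs₀.le
  have key : ∀ T : Finset W, ∃ (X' : Fin M → W → V) (B' : Finset (Fin M)),
      IsPartialBlowup H G A (S ∪ T) X' B' ∧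
      (1 - δ) ^ #T * s ≤ ∑ i ∈ B', extensionDensity A F (S ∪ T) (X' i) := by
    intro T
    induction T using Finset.induction_on with
    | empty => exact ⟨X, B, by simpa using hX, by simpa using hs⟩
    | insert v T hv ih =>
      obtain ⟨X', B', hX', hs'⟩ := ih
      rw [union_insert, card_insert_of_notMem hv]
      by_cases hvS : v ∈ S ∪ T
      · rw [insert_eq_of_mem hvS]
        -- A vertex already in `S` also gives up a factor `1 - δ`, which keeps the exponent uniform.
        refine ⟨X', B', hX', le_trans ?_ hs'⟩
        rw [pow_succ]
        have : 0 < (1 - δ) ^ #T * s := by positivity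
        nlinarith
      · obtain ⟨X'', B'', h1, h2⟩ := hX'.insert hF hs' (by positivity) hδ₁ hvS
          ((hM v).trans (by gcongr δ * ?_ * _; exact hle _ (card_le_univ T)))
        exact ⟨X'', B'', h1, le_trans (le_of_eq (by ring)) h2⟩
  obtain ⟨X', B', h1, h2⟩ := key univ
  rw [union_eq_right.2 (subset_univ S)] at h1 h2
  refine ⟨X', B', h1, h2.trans ?_⟩
  simpa using sum_le_card_nsmul B' _ 1 fun i _ => extensionDensity_le_one A F univ (X' i)

theorem IsPartialBlowup.isContained {W V : Type*} [Fintype W] {H : SimpleGraph W}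
    {G : SimpleGraph V} {A : W → Finset V} (hA : Pairwise fun a b => Disjoint (A a) (A b))
    {M : ℕ} {X : Fin M → W → V} {B : Finset (Fin M)} (hX : IsPartialBlowup H G A univ X B)
    {t : ℕ} (ht : t ≤ #B) : (H.blowup t).IsContained G := by
  let e : Fin t ↪ B := (Fin.castLEEmb ht).trans B.equivFin.symm.toEmbedding
  refine ⟨⟨⟨fun p => X (e p.2) p.1, fun {p q} h => ?_⟩, ?_⟩⟩
  · exact hX.2.2 _ (mem_univ _) _ (mem_univ _) h _ (e p.2).2 _ (e q.2).2
  · rintro ⟨a, i⟩ ⟨b, j⟩ h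
    have h' : X (e i) a = X (e j) b := h
    have hab : a = b := by
      by_contra hne
      have h1 := hX.1 a (mem_univ _) _ (e i).2
      have h2 := hX.1 b (mem_univ _) _ (e j).2
      rw [h'] at h1
      exact disjoint_left.1 (hA hne) h1 h2
    subst hab
    have := hX.2.1 a (mem_univ _) (e i).2 (e j).2 h'
    exact Prod.ext rfl (e.injective (Subtype.ext this))

/-- The weight of a pair is its extension density, which vanishes off the edges of `G` and has mean
`τ`; the weighted biclique seeds the extension process. -/
theorem blowup_isContained_of_box {W V : Type*} [Fintype W] {H : SimpleGraph W}
    {G : SimpleGraph V} {A : W → Finset V} (hA : Pairwise fun a b => Disjoint (A a) (A b))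
    {F : Finset (W → V)} (hFA : F ⊆ piFinset A)
    (hF : ∀ x ∈ F, ∀ a b, H.Adj a b → G.Adj (x a) (x b)) {a b : W} (hab : H.Adj a b)
    {τ d δ x : ℝ} {M : ℕ} (hτ₀ : 0 < τ) (hd₀ : 0 < d) (hδ : 0 < δ) (hδ₁ : δ < 1)
    (hτ : τ * #(piFinset A) = #F) (hd : (#(G.interedges (A a) (A b)) : ℝ) ≤ d * #(A a) * #(A b))
    (hne : ∀ w, (A w).Nonempty) (hM : 1 ≤ M)
    (hM1 : ∀ w, (M : ℝ) ^ 2 ≤ τ / d / 30 * (τ / 3) ^ M * #(A w))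
    (hM2 : ∀ w, (M : ℝ) ^ 2 * 2 ^ M ≤
      δ * ((1 - δ) ^ Fintype.card W * (3 / 5 * (τ / d) * M)) * #(A w))
    (hx : x ≤ (1 - δ) ^ Fintype.card W * (3 / 5 * (τ / d) * M)) :
    (H.blowup ⌈x⌉₊).IsContained G := by
  have hM' : (1 : ℝ) ≤ M := by exact_mod_cast hM
  choose x₀ hx₀ using hne
  have hpi : (0 : ℝ) < #(piFinset A) := by
    exact_mod_cast card_pos.2 ⟨x₀, by simpa using hx₀⟩
  have hne : a ≠ b := hab.ne
  set S : Finset W := {b, a} with hS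
  -- The filler `x₀` is immaterial: the density over `S` only reads the coordinates `a` and `b`.
  set p : V → V → W → V := fun u v => Function.update (Function.update x₀ a u) b v with hp
  have hxa : ∀ u v, p u v a = u := fun u v => by simp [hp, hne]
  have hxb : ∀ u v, p u v b = v := fun u v => by simp [hp]
  obtain ⟨y, z, hyA, hzA, hy, hz, hyz, hsum⟩ := exists_weighted_biclique G.Adj (A a) (A b)
    (fun u v => extensionDensity A F S (p u v)) τ d M
    (fun u v => extensionDensity_le_one _ _ _ _)
    (fun u v huv => by
      by_contra h
      obtain ⟨y, hyF, hy⟩ := exists_mem_of_extensionDensity_ne_zero h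
      have h1 := hy a (by simp [hS])
      have h2 := hy b (by simp [hS])
      rw [hxa] at h1; rw [hxb] at h2
      exact huv (h1 ▸ h2 ▸ hF y hyF a b hab))
    hτ₀ hd₀
    (by
      rw [sum_comm]
      have h1 : ∀ u, ∑ v ∈ A b, extensionDensity A F S (p u v) =
          #(A b) * extensionDensity A F {a} (Function.update x₀ a u) := fun u =>
        sum_extensionDensity_insert (by simpa using hne.symm)
      have h2 : ∑ u ∈ A a, extensionDensity A F {a} (Function.update x₀ a u) =
          #(A a) * extensionDensity A F ∅ x₀ := by
        rw [← sum_extensionDensity_insert (notMem_empty a), insert_empty_eq]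
      simp only [h1, ← mul_sum, h2, extensionDensity_empty hFA, ← hτ]
      rw [mul_div_cancel_right₀ _ hpi.ne']
      exact le_of_eq (by ring))
    (by
      refine le_trans (le_of_eq ?_) hd
      rw [SimpleGraph.interedges_def, card_filter, sum_product_right]
      push_cast [card_filter]
      rfl)
    hM (hM1 a) (by nlinarith [hM1 b])
  have hX : IsPartialBlowup H G A S (fun i => p (y i) (z i)) univ := by
    have hmem : ∀ w ∈ S, w = b ∨ w = a := fun w hw => by simpa [hS] using hw
    refine ⟨fun w hw i _ => ?_, fun w hw i _ j _ hij => ?_, fun w hw w' hw' h i _ j _ => ?_⟩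
    · rcases hmem w hw with h | h <;> subst h
      · simpa only [hxb] using hzA i
      · simpa only [hxa] using hyA i
    · rcases hmem w hw with h | h <;> subst h
      · exact hz (by simpa only [hxb] using hij)
      · exact hy (by simpa only [hxa] using hij)
    · rcases hmem w hw with h₁ | h₁ <;> rcases hmem w' hw' with h₂ | h₂ <;> rw [h₁, h₂] at h ⊢
      · exact (H.irrefl h).elim
      · simpa only [hxa, hxb] using (hyz j i).symm
      · simpa only [hxa, hxb] using hyz i j
      · exact (H.irrefl h).elim
  obtain ⟨X', B', hX', hB'⟩ := hX.extend hF hsum (by positivity) hδ hδ₁ hM2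
  exact hX'.isContained hA (Nat.ceil_le.2 (hx.trans hB'))

/-! ### Counting copies in uniform boxes -/

/-- No lower bound on the subsets is needed: when one is too small for uniformity to apply, the left
side is already below the error term because densities are at most 1. -/
theorem SimpleGraph.IsUniform.edgeDensity_mul_le {V : Type*} {G : SimpleGraph V} {ε : ℝ}
    (hε : 0 ≤ ε) {A B U T : Finset V} (h : G.IsUniform ε A B) (hU : U ⊆ A) (hT : T ⊆ B) :
    (G.edgeDensity A B : ℝ) * (#U * #T) ≤ #(G.interedges U T) + ε * (#A * #B) := by
  have hUA : (#U : ℝ) ≤ #A := by exact_mod_cast card_le_card hU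
  have hTB : (#T : ℝ) ≤ #B := by exact_mod_cast card_le_card hT
  have hd1 : (G.edgeDensity A B : ℝ) ≤ 1 := by exact_mod_cast G.edgeDensity_le_one A B
  have hsmall : (#U : ℝ) * #T ≤ ε * (#A * #B) →
      (G.edgeDensity A B : ℝ) * (#U * #T) ≤ #(G.interedges U T) + ε * (#A * #B) := fun hs => by
    have : (G.edgeDensity A B : ℝ) * (#U * #T) ≤ 1 * (#U * #T) := by gcongr
    have : (0 : ℝ) ≤ #(G.interedges U T) := by positivity
    linarith
  rcases lt_or_ge (#U : ℝ) (#A * ε) with hu | hu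
  · exact hsmall (by
      calc (#U : ℝ) * #T ≤ (#A * ε) * #B := by gcongr
        _ = _ := by ring)
  rcases lt_or_ge (#T : ℝ) (#B * ε) with ht | ht
  · exact hsmall (by
      calc (#U : ℝ) * #T ≤ #A * (#B * ε) := by gcongr
        _ = _ := by ring)
  have h1 := (abs_lt.1 (h hU hT hu ht)).1
  have h2 : (G.edgeDensity U T : ℝ) * (#U * #T) = #(G.interedges U T) := by
    have hcard : #(G.interedges U T) ≤ #U * #T := G.card_interedges_le_mul U T
    rw [SimpleGraph.edgeDensity_def]
    push_cast
    rcases eq_or_ne ((#U : ℝ) * #T) 0 with h0 | h0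
    · rw [h0, mul_zero]
      have : #U * #T = 0 := by exact_mod_cast h0
      rw [this] at hcard
      simp [Nat.le_zero.1 hcard]
    · rw [div_mul_cancel₀ _ h0]
  calc (G.edgeDensity A B : ℝ) * (#U * #T) ≤ (G.edgeDensity U T + ε) * (#U * #T) := by
        gcongr; linarith
    _ = #(G.interedges U T) + ε * (#U * #T) := by rw [add_mul, h2]
    _ ≤ _ := by gcongr

/-- The density of the pair of parts of the box `A` that belongs to the edge `e`. -/
noncomputable def pairDensity {W V : Type*} (G : SimpleGraph V) (A : W → Finset V) :
    Sym2 W → ℝ :=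
  Sym2.lift ⟨fun a b => G.edgeDensity (A a) (A b), fun a b => by
    simp only [G.edgeDensity_comm (A a)]⟩

theorem pairDensity_nonneg {W V : Type*} {G : SimpleGraph V} {A : W → Finset V} (e : Sym2 W) :
    0 ≤ pairDensity G A e := by
  induction e with | _ a b =>
    change (0 : ℝ) ≤ G.edgeDensity (A a) (A b)
    exact_mod_cast G.edgeDensity_nonneg (A a) (A b)

theorem pairDensity_le_one {W V : Type*} {G : SimpleGraph V} {A : W → Finset V} (e : Sym2 W) :
    pairDensity G A e ≤ 1 := by
  induction e with | _ a b =>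
    change (G.edgeDensity (A a) (A b) : ℝ) ≤ 1
    exact_mod_cast G.edgeDensity_le_one (A a) (A b)

/-- The points of the box `A` that map every pair in `E` to an edge of `G`. -/
noncomputable def boxCopies {W V : Type*} [Fintype W] (G : SimpleGraph V) (A : W → Finset V)
    (E : Finset (Sym2 W)) : Finset (W → V) :=
  {x ∈ piFinset A | ∀ e ∈ E, e.map x ∈ G.edgeSet}

section counting
variable {W V : Type*} [Fintype W] {G : SimpleGraph V} {A : W → Finset V} {ε : ℝ}

/-- Freeze all coordinates except `a` and `b`. No pair in `E` contains both, so the constraints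
split into one on `u` and one on `v`; the admissible pairs form a rectangle `U × T`, to which
uniformity applies. -/
theorem pairDensity_mul_card_boxCopies_le (hε : 0 ≤ ε) (hne : ∀ w, (A w).Nonempty) {a b : W}
    (hab : a ≠ b) (hunif : G.IsUniform ε (A a) (A b)) {E : Finset (Sym2 W)} (hE : s(a, b) ∉ E) :
    pairDensity G A s(a, b) * #(boxCopies G A E) ≤
      #(boxCopies G A (insert s(a, b) E)) + ε * #(piFinset A) := by
  have hmap : ∀ (e : Sym2 W) (x y : W → V), (∀ w ∈ e, x w = y w) → e.map x = e.map y :=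
    fun e x y h => Sym2.map_congr h
  have hne' : ∀ w, (0 : ℝ) < #(A w) := fun w => by exact_mod_cast (hne w).card_pos
  have key : ∀ g : (W → V) → ℝ, (#(A a) : ℝ) * #(A b) * ∑ x ∈ piFinset A, g x =
      ∑ x ∈ piFinset A, ∑ u ∈ A a, ∑ v ∈ A b,
        g (Function.update (Function.update x a u) b v) := fun g => by
    rw [mul_assoc, card_mul_sum_piFinset A b g, card_mul_sum_piFinset A a]
  set d := pairDensity G A s(a, b) with hd
  have hdef : d = G.edgeDensity (A a) (A b) := rfl
  set p : (W → V) → Prop := fun x => ∀ e ∈ E, e.map x ∈ G.edgeSet with hp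
  set g : (W → V) → ℝ := fun x =>
    d * (if p x then 1 else 0) - (if p x ∧ G.Adj (x a) (x b) then 1 else 0) with hg
  have hgsum : ∑ x ∈ piFinset A, g x =
      d * #(boxCopies G A E) - #(boxCopies G A (insert s(a, b) E)) := by
    have : boxCopies G A (insert s(a, b) E) =
        {x ∈ piFinset A | p x ∧ G.Adj (x a) (x b)} := by
      ext x
      simp [boxCopies, hp, and_comm]
    rw [this]
    simp only [hg, sum_sub_distrib, ← mul_sum, boxCopies, card_filter, hp]
    push_cast
    rfl
  have hlocal : ∀ x ∈ piFinset A, ∑ u ∈ A a, ∑ v ∈ A b,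
      g (Function.update (Function.update x a u) b v) ≤ ε * (#(A a) * #(A b)) := by
    intro x _
    set U := {u ∈ A a | ∀ e ∈ E, a ∈ e → e.map (Function.update x a u) ∈ G.edgeSet} with hU
    set T := {v ∈ A b | ∀ e ∈ E, a ∉ e → e.map (Function.update x b v) ∈ G.edgeSet} with hT
    have hpUT : ∀ u ∈ A a, ∀ v ∈ A b,
        (p (Function.update (Function.update x a u) b v) ↔ u ∈ U ∧ v ∈ T) := by
      intro u hu v hv
      have h1 : ∀ e ∈ E, a ∈ e → e.map (Function.update (Function.update x a u) b v) =
          e.map (Function.update x a u) := fun e he hae => hmap _ _ _ fun w hw => by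
        have : w ≠ b := by
          rintro rfl
          exact hE ((Sym2.mem_and_mem_iff hab).1 ⟨hae, hw⟩ ▸ he)
        simp [this]
      have h2 : ∀ e ∈ E, a ∉ e → e.map (Function.update (Function.update x a u) b v) =
          e.map (Function.update x b v) := fun e he hae => hmap _ _ _ fun w hw => by
        have : w ≠ a := by rintro rfl; exact hae hw
        by_cases hwb : w = b
        · subst hwb; simp
        · simp [this, hwb]
      simp only [hp, hU, hT, mem_filter, hu, hv, true_and]
      refine ⟨fun h => ⟨fun e he hae => h1 e he hae ▸ h e he,
        fun e he hae => h2 e he hae ▸ h e he⟩, fun h e he => ?_⟩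
      by_cases hae : a ∈ e
      · rw [h1 e he hae]; exact h.1 e he hae
      · rw [h2 e he hae]; exact h.2 e he hae
    have hUA : U ⊆ A a := filter_subset _ _
    have hTB : T ⊆ A b := filter_subset _ _
    have hcalc : ∑ u ∈ A a, ∑ v ∈ A b, g (Function.update (Function.update x a u) b v) =
        d * (#U * #T) - #(G.interedges U T) := by
      have h1 : ∀ u ∈ A a, ∀ v ∈ A b, g (Function.update (Function.update x a u) b v) =
          d * (if (u, v) ∈ U ×ˢ T then 1 else 0) -
            (if (u, v) ∈ G.interedges U T then 1 else 0) := by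
        intro u hu v hv
        simp only [hg, hpUT u hu v hv, mem_product, SimpleGraph.mem_interedges_iff]
        simp [hab, and_assoc]
      rw [sum_congr rfl fun u hu => sum_congr rfl (h1 u hu)]
      rw [← sum_product' (A a) (A b) fun u v => d * (if (u, v) ∈ U ×ˢ T then (1 : ℝ) else 0) -
            (if (u, v) ∈ G.interedges U T then 1 else 0)]
      simp only [sum_sub_distrib, ← mul_sum, sum_boole, Prod.mk.eta, filter_mem_eq_inter]
      rw [inter_eq_right.2 (product_subset_product hUA hTB), inter_eq_right.2, card_product]
      · push_cast; rfl
      · intro q hq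
        have := (G.mem_interedges_iff).1 hq
        exact mem_product.2 ⟨hUA this.1, hTB this.2.1⟩
    rw [hcalc, hdef]
    linarith [hunif.edgeDensity_mul_le hε hUA hTB]
  have hfin : (#(A a) : ℝ) * #(A b) * ∑ x ∈ piFinset A, g x ≤
      #(A a) * #(A b) * (ε * #(piFinset A)) := by
    rw [key]
    refine (sum_le_card_nsmul _ _ _ hlocal).trans (le_of_eq ?_)
    rw [nsmul_eq_mul]; ring
  have := le_of_mul_le_mul_left hfin (mul_pos (hne' a) (hne' b))
  linarith

/-- The counting lemma (lower bound) for a box with uniform pairs. -/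
theorem prod_pairDensity_mul_card_le (hε : 0 ≤ ε) (hne : ∀ w, (A w).Nonempty)
    (hunif : Pairwise fun a b => G.IsUniform ε (A a) (A b)) (E : Finset (Sym2 W))
    (hE : ∀ e ∈ E, ¬ e.IsDiag) :
    (∏ e ∈ E, pairDensity G A e) * #(piFinset A) ≤
      #(boxCopies G A E) + #E * ε * #(piFinset A) := by
  induction E using Finset.induction_on with
  | empty => simp [boxCopies]
  | insert e E he ih =>
    induction e with | _ a b =>
    have hab : a ≠ b := by simpa using hE s(a, b) (by simp)
    have ih := ih fun e he => hE e (by simp [he])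
    have h1 := pairDensity_mul_card_boxCopies_le hε hne hab (hunif hab) he
    rw [prod_insert he, card_insert_of_notMem he]
    have h0 := pairDensity_nonneg (G := G) (A := A) s(a, b)
    have hle := pairDensity_le_one (G := G) (A := A) s(a, b)
    have h2 := mul_le_mul_of_nonneg_left ih h0
    have h3 : pairDensity G A s(a, b) * (#E * ε * #(piFinset A)) ≤
      1 * (#E * ε * #(piFinset A)) := by gcongr
    push_cast
    nlinarith

end counting

/-! ### Regular partitions and the choice of a box -/

/-- Most pairs of vertices lie in distinct parts forming a uniform pair. -/
theorem exists_finpartition_card_bad_pairs_le {ε γ : ℝ} (hε : 0 < ε) (hγ : 0 < γ)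
    (hεγ : 8 * ε ≤ γ) : ∃ (c : ℝ) (N : ℕ), 0 < c ∧ ∀ (V : Type*) [Fintype V],
      N ≤ Fintype.card V → ∀ (G : SimpleGraph V), ∃ P : Finpartition (univ : Finset V),
        (∀ s ∈ P.parts, c * Fintype.card V ≤ #s) ∧
        (#{q : V × V | P.part q.1 = P.part q.2 ∨ ¬ G.IsUniform ε (P.part q.1) (P.part q.2)} : ℝ)
          ≤ γ * (Fintype.card V : ℝ) ^ 2 := by
  -- With at least 4/γ parts, pairs inside a part number at most (γ/2)n². Non-uniform pairs of parts
  -- cover at most 4εn² ≤ (γ/2)n².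
  set l := max 1 ⌈4 / γ⌉₊ with hl
  set K := SzemerediRegularity.bound ε l with hK
  have hlK : l ≤ K := SzemerediRegularity.le_bound ε l
  have hl1 : 1 ≤ l := le_max_left _ _
  have hK0 : (0 : ℝ) < K := by exact_mod_cast (by omega : 0 < K)
  refine ⟨1 / (2 * K), K, by positivity, fun V _ hV G => ?_⟩
  obtain ⟨P, hPe, hPl, hPK, hPu⟩ := szemeredi_regularity G hε (hlK.trans hV)
  set n := Fintype.card V with hn
  set p := #P.parts with hp
  have hp0 : 0 < p := by omega
  have hpn : p ≤ n := hPK.trans hV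
  have hp0' : (0 : ℝ) < p := by exact_mod_cast hp0
  have hn0 : (0 : ℝ) < n := by exact_mod_cast (by omega : 0 < n)
  have hdiv1 : 1 ≤ n / p := (Nat.one_le_div_iff hp0).2 hpn
  have hlow : ∀ s ∈ P.parts, (n : ℝ) / (2 * p) ≤ #s := fun s hs => by
    have h1 : n / p ≤ #s := by simpa using hPe.average_le_card_part hs
    have h2 : n < p * (n / p + 1) := Nat.lt_mul_div_succ n hp0
    have h3 : n ≤ #s * (2 * p) := by nlinarith
    rw [div_le_iff₀ (by positivity)]
    exact_mod_cast h3
  have hup : ∀ s ∈ P.parts, (#s : ℝ) ≤ 2 * n / p := fun s hs => by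
    have h1 : #s ≤ n / p + 1 := by simpa using hPe.card_part_le_average_add_one hs
    have h2 : n / p * p ≤ n := Nat.div_mul_le_self n p
    have h3 : #s * p ≤ 2 * n := by nlinarith
    rw [le_div_iff₀ hp0']
    exact_mod_cast h3
  refine ⟨P, fun s hs => le_trans ?_ (hlow s hs), ?_⟩
  · have : (p : ℝ) ≤ K := by exact_mod_cast hPK
    rw [one_div_mul_eq_div]
    gcongr
  have hsub : ({q : V × V | P.part q.1 = P.part q.2 ∨
      ¬ G.IsUniform ε (P.part q.1) (P.part q.2)} : Finset (V × V)) ⊆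
      (P.parts.biUnion fun s => s ×ˢ s) ∪ (P.nonUniforms G ε).biUnion fun q => q.1 ×ˢ q.2 := by
    rintro ⟨u, v⟩ h
    simp only [mem_filter, mem_univ, true_and] at h
    have hu := P.part_mem.2 (mem_univ u)
    have hv := P.part_mem.2 (mem_univ v)
    have hu' := P.mem_part (mem_univ u)
    have hv' := P.mem_part (mem_univ v)
    rw [mem_union, mem_biUnion, mem_biUnion]
    by_cases heq : P.part u = P.part v
    · exact Or.inl ⟨_, hu, mem_product.2 ⟨hu', heq ▸ hv'⟩⟩
    · refine Or.inr ⟨(P.part u, P.part v), ?_, mem_product.2 ⟨hu', hv'⟩⟩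
      exact (P.mk_mem_nonUniforms G).2 ⟨hu, hv, heq, h.resolve_left heq⟩
  have hfirst : (#(P.parts.biUnion fun s => s ×ˢ s) : ℝ) ≤ γ / 2 * (n : ℝ) ^ 2 := by
    have h1 : (#(P.parts.biUnion fun s => s ×ˢ s) : ℝ) ≤ ∑ s ∈ P.parts, (#s : ℝ) * #s := by
      have : #(P.parts.biUnion fun s => s ×ˢ s) ≤ ∑ s ∈ P.parts, #(s ×ˢ s) := card_biUnion_le
      simp only [card_product] at this
      exact_mod_cast this
    have h2 : ∑ s ∈ P.parts, (#s : ℝ) * #s ≤ ∑ s ∈ P.parts, 2 * n / p * (#s : ℝ) :=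
      sum_le_sum fun s hs => by gcongr; exact hup s hs
    have h3 : ∑ s ∈ P.parts, (#s : ℝ) = n := by
      exact_mod_cast P.sum_card_parts
    rw [← mul_sum, h3] at h2
    have hpγ : 4 / γ ≤ p := (Nat.le_ceil _).trans (by exact_mod_cast (le_max_right _ _).trans hPl)
    have h4 : 2 / (p : ℝ) ≤ γ / 2 := by
      rw [div_le_iff₀ hγ] at hpγ
      rw [div_le_iff₀ hp0']; linarith
    calc _ ≤ _ := h1.trans h2
      _ = 2 / (p : ℝ) * (n : ℝ) ^ 2 := by ring
      _ ≤ _ := by gcongr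
  have hsecond : (#((P.nonUniforms G ε).biUnion fun q => q.1 ×ˢ q.2) : ℝ) ≤
      γ / 2 * (n : ℝ) ^ 2 := by
    have h1 : (#((P.nonUniforms G ε).biUnion fun q => q.1 ×ˢ q.2) : ℝ) ≤
        ∑ q ∈ P.nonUniforms G ε, (#q.1 : ℝ) * #q.2 := by
      have : #((P.nonUniforms G ε).biUnion fun q => q.1 ×ˢ q.2) ≤
        ∑ q ∈ P.nonUniforms G ε, #(q.1 ×ˢ q.2) := card_biUnion_le
      simp only [card_product] at this
      exact_mod_cast this
    have h2 : ∑ q ∈ P.nonUniforms G ε, (#q.1 : ℝ) * #q.2 ≤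
        #(P.nonUniforms G ε) * (2 * n / p * (2 * n / p)) := by
      rw [← nsmul_eq_mul]
      refine sum_le_card_nsmul _ _ _ fun q hq => ?_
      obtain ⟨h1, h2, -⟩ := (P.mk_mem_nonUniforms G).1 hq
      have := hup _ h1
      have := hup _ h2
      gcongr
    have h3 : (#(P.nonUniforms G ε) : ℝ) ≤ p * p * ε := by
      refine hPu.trans ?_
      gcongr
      exact_mod_cast Nat.mul_le_mul_left p (Nat.sub_le p 1)
    calc _ ≤ _ := h1.trans h2
      _ ≤ p * p * ε * (2 * n / p * (2 * n / p)) := by gcongr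
      _ = 4 * ε * (n : ℝ) ^ 2 := by field_simp; ring
      _ ≤ _ := by gcongr; linarith
  calc _ ≤ (#((P.parts.biUnion fun s => s ×ˢ s) ∪
        (P.nonUniforms G ε).biUnion fun q => q.1 ×ˢ q.2) : ℝ) := by
        exact_mod_cast card_le_card hsub
    _ ≤ (#(P.parts.biUnion fun s => s ×ˢ s) : ℝ) +
        #((P.nonUniforms G ε).biUnion fun q => q.1 ×ˢ q.2) := by exact_mod_cast card_union_le _ _
    _ ≤ _ := by linarith

/-- The number of maps sending the pair `(a, b)` to a given set of pairs. -/
theorem card_pair_mem_eq {W V : Type*} [Fintype W] [Fintype V] {a b : W} (hab : a ≠ b)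
    (D : Finset (V × V)) :
    (Fintype.card V : ℝ) ^ 2 * #{x : W → V | (x a, x b) ∈ D} =
      #D * (Fintype.card V : ℝ) ^ Fintype.card W := by
  set A : W → Finset V := fun _ => univ with hA
  have hpi : piFinset A = univ := by ext; simp [hA]
  set g : (W → V) → ℝ := fun x => if (x a, x b) ∈ D then 1 else 0 with hg
  have h1 := card_mul_sum_piFinset A b g
  have h2 := card_mul_sum_piFinset A a
    fun x => ∑ v ∈ A b, g (Function.update x b v)
  rw [← h1] at h2
  have h3 : ∀ x : W → V, ∑ u ∈ A a, ∑ v ∈ A b,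
      g (Function.update (Function.update x a u) b v) = #D := fun x => by
    simp only [hg, hA, Function.update_self, Function.update_of_ne hab]
    rw [← sum_product' univ univ fun u v => if (u, v) ∈ D then (1 : ℝ) else 0]
    simp
  simp only [h3, hpi] at h2
  simp only [hA, card_univ, hg, sum_boole, sum_const, nsmul_eq_mul, Fintype.card_fun] at h2
  push_cast at h2
  linarith

/-- A box of pairwise uniform parts that inherits the density of a set `F` of maps. -/
theorem exists_uniform_box {W : Type*} [Fintype W] [Nonempty W] {ε γ η : ℝ} (hε : 0 < ε) (hγ : 0 < γ)
    (hγη : γ < η) (hεγ : 8 * (Fintype.card W : ℝ) ^ 2 * ε ≤ γ) : ∃ (c : ℝ) (N : ℕ), 0 < c ∧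
      ∀ (V : Type*) [Fintype V], N ≤ Fintype.card V → ∀ (G : SimpleGraph V) (F : Finset (W → V)),
        η * (Fintype.card V : ℝ) ^ Fintype.card W ≤ #F → ∃ A : W → Finset V,
          (Pairwise fun a b => Disjoint (A a) (A b)) ∧
          (Pairwise fun a b => G.IsUniform ε (A a) (A b)) ∧ (∀ w, (A w).Nonempty) ∧
          (∀ w, c * Fintype.card V ≤ #(A w)) ∧
          (η - γ) * #(piFinset A) ≤ #{x ∈ piFinset A | x ∈ F} := by
  set k := Fintype.card W with hk
  have hk1 : (0 : ℝ) < k := by exact_mod_cast Fintype.card_pos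
  obtain ⟨c, N, hc, hN⟩ := exists_finpartition_card_bad_pairs_le (γ := γ / (k : ℝ) ^ 2)
    hε (by positivity) (by
      rw [le_div_iff₀ (by positivity)]
      linarith)
  refine ⟨c, max 1 N, hc, fun V _ hV G F hF => ?_⟩
  obtain ⟨P, hPc, hPD⟩ := hN V ((le_max_right _ _).trans hV) G
  set n := Fintype.card V with hn
  have hn0 : (0 : ℝ) < n := by exact_mod_cast (le_max_left _ _).trans hV
  set D : Finset (V × V) :=
    {q : V × V | P.part q.1 = P.part q.2 ∨ ¬ G.IsUniform ε (P.part q.1) (P.part q.2)} with hD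
  set bad : Finset (W → V) := (univ : Finset W).offDiag.biUnion fun q =>
    {x : W → V | (x q.1, x q.2) ∈ D} with hbad
  have hbadcard : (#bad : ℝ) ≤ γ * (n : ℝ) ^ k := by
    have hone : ∀ q ∈ (univ : Finset W).offDiag, (#{x : W → V | (x q.1, x q.2) ∈ D} : ℝ) ≤
        γ / (k : ℝ) ^ 2 * (n : ℝ) ^ k := fun q hq => by
      have h1 := card_pair_mem_eq (by simpa using hq) D (a := q.1) (b := q.2)
      refine le_of_mul_le_mul_left (h1.le.trans ?_) (by positivity : (0 : ℝ) < (n : ℝ) ^ 2)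
      calc _ ≤ γ / (k : ℝ) ^ 2 * (n : ℝ) ^ 2 * (n : ℝ) ^ k := by gcongr
        _ = _ := by ring
    have h2 : (#bad : ℝ) ≤ ∑ q ∈ (univ : Finset W).offDiag,
        (#{x : W → V | (x q.1, x q.2) ∈ D} : ℝ) := by exact_mod_cast card_biUnion_le
    have h3 : (#(univ : Finset W).offDiag : ℝ) ≤ (k : ℝ) ^ 2 := by
      have : #(univ : Finset W).offDiag ≤ k * k := by rw [offDiag_card]; simp [hk]
      rw [sq]; exact_mod_cast this
    calc _ ≤ _ := h2.trans (sum_le_card_nsmul _ _ _ hone)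
      _ = #(univ : Finset W).offDiag * (γ / (k : ℝ) ^ 2 * (n : ℝ) ^ k) := by
        rw [nsmul_eq_mul]
      _ ≤ (k : ℝ) ^ 2 * (γ / (k : ℝ) ^ 2 * (n : ℝ) ^ k) := by gcongr
      _ = _ := by field_simp
  have hgood : (η - γ) * (n : ℝ) ^ k ≤ #(F \ bad) := by
    have : #F ≤ #(F \ bad) + #bad := by
      have := le_card_sdiff bad F; omega
    have : (#F : ℝ) ≤ #(F \ bad) + #bad := by exact_mod_cast this
    linarith
  set type : (W → V) → W → Finset V := fun x w => P.part (x w) with htype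
  -- The types split all maps into boxes, and averaging gives a box where the good maps have density
  -- at least `η - γ`.
  obtain ⟨A, hAim, hA⟩ : ∃ A ∈ univ.image type, ∑ x with type x = A, (η - γ) ≤
      ∑ x with type x = A, if x ∈ F \ bad then (1 : ℝ) else 0 := by
    have hne : Nonempty V := Fintype.card_pos_iff.1 (by exact_mod_cast hn0)
    refine exists_le_of_sum_le (univ_nonempty.image type) ?_
    rw [sum_fiberwise_of_maps_to fun x _ => mem_image_of_mem _ (mem_univ x),
      sum_fiberwise_of_maps_to fun x _ => mem_image_of_mem _ (mem_univ x)]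
    simp only [sum_const, card_univ, Fintype.card_fun, sum_boole, filter_mem_eq_inter,
      univ_inter, nsmul_eq_mul, Nat.cast_pow]
    linarith
  obtain ⟨x₀, -, hx₀⟩ := mem_image.1 hAim
  have hfib : ({x | type x = A} : Finset (W → V)) = piFinset A := by
    ext x
    simp only [mem_filter, mem_univ, true_and, mem_piFinset, ← hx₀, htype, funext_iff]
    refine forall_congr' fun w => ?_
    exact (P.mem_part_iff_part_eq_part (mem_univ _) (mem_univ _)).symm
  rw [hfib] at hA
  have hA' : (η - γ) * #(piFinset A) ≤ #{x ∈ piFinset A | x ∈ F \ bad} := by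
    simp only [sum_const, sum_boole, nsmul_eq_mul] at hA
    linarith
  have hx₀A : ∀ w, x₀ w ∈ A w := fun w => by
    rw [← hx₀]; exact P.mem_part (mem_univ _)
  have hpi : (0 : ℝ) < #(piFinset A) := by
    exact_mod_cast card_pos.2 ⟨x₀, by simpa using hx₀A⟩
  -- A single good map in the box certifies that all its parts are distinct and pairwise uniform,
  -- since these properties depend only on the type.
  obtain ⟨x, hx⟩ : {x ∈ piFinset A | x ∈ F \ bad}.Nonempty := by
    rw [← Finset.card_pos]
    have : (0 : ℝ) < (η - γ) * #(piFinset A) := mul_pos (by linarith) hpi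
    exact_mod_cast this.trans_le hA'
  have hxA : type x = A := by
    have := (mem_filter.1 hx).1
    rw [← hfib] at this
    exact (mem_filter.1 this).2
  have hxD : ∀ a b, a ≠ b → (x a, x b) ∉ D := fun a b hab h =>
    (mem_sdiff.1 (mem_filter.1 hx).2).2 (mem_biUnion.2 ⟨(a, b), by simpa using hab, by simpa using h⟩)
  have hxw : ∀ w, A w = P.part (x w) := fun w => by rw [← hxA]
  have hparts : ∀ w, A w ∈ P.parts := fun w => hxw w ▸ P.part_mem.2 (mem_univ _)
  refine ⟨A, fun a b hab => ?_, fun a b hab => ?_, fun w => ⟨_, hx₀A w⟩,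
    fun w => hPc _ (hparts w), hA'.trans ?_⟩
  · refine P.disjoint (hparts a) (hparts b) fun h => hxD a b hab ?_
    rw [hxw, hxw] at h
    simp [hD, h]
  · by_contra h
    simp only [hxw] at h
    exact hxD a b hab (by simp [hD, h])
  · exact_mod_cast card_le_card fun x hx => by
      rw [mem_filter] at hx ⊢
      exact ⟨hx.1, (mem_sdiff.1 hx.2).1⟩

/-! ### Numerical estimates -/

-- The power of η is n^(-22/25) up to a constant, as 2/5 · 11/5 = 22/25. The remaining n^(3/25)
-- beats log² n.
open Filter in
theorem eventually_sq_ceil_log_le {η : ℝ} (hη₀ : 0 < η) (hη₁ : η < Real.exp (-1)) {C : ℝ}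
    (hC : 0 < C) : ∀ᶠ n : ℕ in atTop,
      C * (⌈2 / 5 * Real.log n / Real.log (1 / η)⌉₊ : ℝ) ^ 2 ≤
        n * (η ^ (11 / 5 : ℝ)) ^ ⌈2 / 5 * Real.log n / Real.log (1 / η)⌉₊ := by
  set L := Real.log (1 / η) with hL
  have hlog : Real.log η = -L := by rw [hL, one_div, Real.log_inv, neg_neg]
  have hL1 : 1 < L := by
    have := Real.log_lt_log hη₀ hη₁
    rw [Real.log_exp] at this; linarith
  have hlogn : Tendsto (fun n : ℕ => Real.log n) atTop atTop :=
    Real.tendsto_log_atTop.comp tendsto_natCast_atTop_atTop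
  have hlo := hlogn.eventually ((isLittleO_pow_exp_pos_mul_atTop (k := 2)
    (by norm_num : (0 : ℝ) < 3 / 25)).bound
      (by positivity : 0 < 1 / (4 * C * Real.exp (11 / 5 * L))))
  filter_upwards [hlo, hlogn.eventually_ge_atTop 1, eventually_gt_atTop 0] with n hn hn1 hn0
  set M := ⌈2 / 5 * Real.log n / L⌉₊ with hM
  set y := Real.log n with hy
  have hn0' : (0 : ℝ) < n := by exact_mod_cast hn0
  have hMlt : (M : ℝ) < 2 / 5 * y / L + 1 := Nat.ceil_lt_add_one (by positivity)
  have hM2 : (M : ℝ) ≤ 2 * y := by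
    have : 2 / 5 * y / L ≤ 2 / 5 * y := div_le_self (by positivity) hL1.le
    linarith
  have hLM : L * M ≤ 2 / 5 * y + L := by
    have := mul_le_mul_of_nonneg_left hMlt.le (by linarith : 0 ≤ L)
    rwa [mul_add, mul_div_cancel₀ _ (by linarith : L ≠ 0), mul_one] at this
  have hright : Real.exp (3 / 25 * y) / Real.exp (11 / 5 * L) ≤ n * (η ^ (11 / 5 : ℝ)) ^ M := by
    rw [Real.rpow_def_of_pos hη₀, hlog, ← Real.exp_nat_mul, ← Real.exp_sub]
    have hexp : (n : ℝ) = Real.exp y := (Real.exp_log hn0').symm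
    rw [hexp, ← Real.exp_add]
    exact Real.exp_le_exp.2 (by linarith)
  rw [Real.norm_of_nonneg (by positivity), Real.norm_of_nonneg (by positivity)] at hn
  refine le_trans ?_ hright
  calc C * (M : ℝ) ^ 2 ≤ C * (2 * y) ^ 2 := by gcongr
    _ = 4 * C * y ^ 2 := by ring
    _ ≤ 4 * C * (1 / (4 * C * Real.exp (11 / 5 * L)) * Real.exp (3 / 25 * y)) := by gcongr
    _ = _ := by field_simp

theorem labelledCopyCount_le_card {W V : Type*} [Fintype W] [Fintype V] (H : SimpleGraph W)
    (G : SimpleGraph V) : G.labelledCopyCount H ≤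
      #{x : W → V | ∀ e ∈ H.edgeFinset, e.map x ∈ G.edgeSet} := by
  unfold SimpleGraph.labelledCopyCount
  rw [← card_univ]
  refine card_le_card_of_injOn (fun f => f) (fun f _ => ?_) fun f _ g _ h => DFunLike.coe_injective h
  simp only [coe_filter, mem_univ, true_and, Set.mem_ofPred_eq, SimpleGraph.mem_edgeFinset]
  intro e he
  induction e with | _ a b => exact f.toHom.map_adj he

/-- The quotient is ((1+δ)τ)^(1-1/m) / (1+δ), increasing in τ, so a box denser than expected only
helps; 1/(1+δ) ≥ 1-δ gives the second factor. -/
theorem div_rpow_ge {δ η τ m : ℝ} (hδ₀ : 0 ≤ δ) (hδ₁ : δ < 1) (hη : 0 < η)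
    (hτ : (1 - δ) * η ≤ τ) (hm : 1 ≤ m) :
    (1 - δ) ^ 2 * η ^ (1 - 1 / m) ≤ τ / ((1 + δ) * τ) ^ (1 / m) := by
  have h1δ : 0 < 1 - δ := by linarith
  have hτ₀ : 0 < τ := (mul_pos h1δ hη).trans_le hτ
  have hp0 : 0 ≤ 1 - 1 / m := by
    rw [sub_nonneg]; exact (div_le_one (by linarith)).2 hm
  have hp1 : 1 - 1 / m ≤ 1 := by
    have : 0 ≤ 1 / m := by positivity
    linarith
  have h1 : (1 - δ) * η ^ (1 - 1 / m) ≤ ((1 + δ) * τ) ^ (1 - 1 / m) := by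
    calc (1 - δ) * η ^ (1 - 1 / m) ≤ (1 - δ) ^ (1 - 1 / m) * η ^ (1 - 1 / m) := by
          gcongr
          exact Real.self_le_rpow_of_le_one h1δ.le (by linarith) hp1
      _ = ((1 - δ) * η) ^ (1 - 1 / m) := (Real.mul_rpow h1δ.le hη.le).symm
      _ ≤ _ := Real.rpow_le_rpow (by positivity) (by nlinarith) hp0
  have h2 : ((1 + δ) * τ) ^ (1 - 1 / m) * ((1 + δ) * τ) ^ (1 / m) = (1 + δ) * τ := by
    rw [← Real.rpow_add (by positivity)]; simp
  rw [le_div_iff₀ (by positivity)]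
  have h3 : (1 - δ) * η ^ (1 - 1 / m) * ((1 + δ) * τ) ^ (1 / m) ≤ (1 + δ) * τ := by
    refine le_trans ?_ h2.le
    gcongr
  have h4 := mul_le_mul_of_nonneg_left h3 h1δ.le
  nlinarith [mul_nonneg (sq_nonneg δ) hτ₀.le]

/-- This is where η < 1/e matters for the biclique: e^(-6/5) < 8/25 < (1-δ)/3 for δ ≤ 1/60, so τ/3
may be replaced by η^(11/5). -/
theorem rpow_le_of_lt_exp_neg_one {η : ℝ} (hη₀ : 0 < η) (hη₁ : η < Real.exp (-1)) :
    η ^ (11 / 5 : ℝ) ≤ 8 / 25 * η := by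
  have h1 : η ^ (11 / 5 : ℝ) = η ^ (6 / 5 : ℝ) * η := by
    nth_rewrite 3 [← Real.rpow_one η]
    rw [← Real.rpow_add hη₀]; norm_num
  have h2 : η ^ (6 / 5 : ℝ) ≤ Real.exp (-(6 / 5)) := by
    refine (Real.rpow_le_rpow hη₀.le hη₁.le (by norm_num)).trans (le_of_eq ?_)
    rw [← Real.exp_mul]; norm_num
  have h3 : Real.exp (-(6 / 5)) ≤ 8 / 25 := by
    rw [Real.exp_neg, inv_le_comm₀ (Real.exp_pos _) (by norm_num),
      show (6 / 5 : ℝ) = 1 + 1 / 5 by norm_num, Real.exp_add]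
    have := Real.exp_one_gt_d9
    have := Real.add_one_le_exp (1 / 5 : ℝ)
    nlinarith
  rw [h1]
  gcongr
  exact h2.trans h3
-- The sparsest pair and the conclusion
/-- In a uniform box with at least `τ * #(piFinset A)` copies of `H`, the sparsest pair has density
at most about `τ ^ (1 / m)`. -/
theorem exists_adj_card_interedges_le {W V : Type*} [Fintype W] {H : SimpleGraph W}
    {G : SimpleGraph V} {A : W → Finset V} {ε δ τ : ℝ} (hH : H.edgeSet.Nonempty) (hε : 0 ≤ ε)
    (hδ : 0 ≤ δ) (hτ₀ : 0 < τ) (hne : ∀ w, (A w).Nonempty)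
    (hunif : Pairwise fun a b => G.IsUniform ε (A a) (A b))
    (hτ : τ * #(piFinset A) = #(boxCopies G A H.edgeFinset))
    (hετ : H.edgeSet.ncard * ε ≤ δ * τ) :
    ∃ a b, H.Adj a b ∧ (#(G.interedges (A a) (A b)) : ℝ) ≤
      ((1 + δ) * τ) ^ (1 / (H.edgeSet.ncard : ℝ)) * #(A a) * #(A b) := by
  set m := H.edgeSet.ncard with hm
  have hmE : m = #H.edgeFinset := by rw [hm, Set.ncard_eq_toFinset_card']; rfl
  have hm0 : 0 < m := (Set.ncard_pos (Set.toFinite _)).2 hH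
  have hpi : (0 : ℝ) < #(piFinset A) := by
    choose x hx using hne
    exact_mod_cast Finset.card_pos.2 ⟨x, by simpa using hx⟩
  have hprod : ∏ e ∈ H.edgeFinset, pairDensity G A e ≤ (1 + δ) * τ := by
    have h1 := prod_pairDensity_mul_card_le hε hne hunif H.edgeFinset
      fun e he => H.not_isDiag_of_mem_edgeSet (SimpleGraph.mem_edgeFinset.1 he)
    rw [← hτ, ← hmE, ← add_mul] at h1
    have h2 := le_of_mul_le_mul_right h1 hpi
    linarith
  set D : ℝ := ((1 + δ) * τ) ^ (1 / (m : ℝ)) with hD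
  have hD₀ : 0 < D := by positivity
  obtain ⟨e, he, heD⟩ : ∃ e ∈ H.edgeFinset, pairDensity G A e ≤ D := by
    by_contra! h
    have h1 := Finset.prod_lt_prod_of_nonempty (fun _ _ => hD₀) h
      (Finset.card_pos.1 (hmE ▸ hm0))
    rw [Finset.prod_const, ← hmE, hD, ← Real.rpow_natCast, ← Real.rpow_mul (by positivity),
      one_div_mul_cancel (by positivity), Real.rpow_one] at h1
    linarith
  induction e with | _ a b =>
  refine ⟨a, b, SimpleGraph.mem_edgeFinset.1 he, ?_⟩
  have hpos : (0 : ℝ) < #(A a) * #(A b) := by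
    exact_mod_cast Nat.mul_pos (hne a).card_pos (hne b).card_pos
  have h1 : ((G.edgeDensity (A a) (A b) : ℚ) : ℝ) ≤ D := heD
  rw [SimpleGraph.edgeDensity_def] at h1
  push_cast at h1
  rw [div_le_iff₀ hpos] at h1
  linarith

theorem blowup_isContained_of_large_box {W V : Type*} [Fintype W] {H : SimpleGraph W}
    {G : SimpleGraph V} {A : W → Finset V} (hA : Pairwise fun a b => Disjoint (A a) (A b))
    {F : Finset (W → V)} (hFA : F ⊆ piFinset A)
    (hF : ∀ x ∈ F, ∀ a b, H.Adj a b → G.Adj (x a) (x b)) {a b : W} (hab : H.Adj a b)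
    {τ D δ η c p L : ℝ} {n : ℕ} (hη₀ : 0 < η) (hη₁ : η < Real.exp (-1))
    (hL : 0 < L) (hn : 1 < n) (hc : 0 < c) (hD₀ : 0 < D) (hδ₀ : 0 < δ) (hδ₁ : δ ≤ 1 / 60)
    (hδk : 19 / 20 ≤ (1 - δ) ^ (Fintype.card W + 2)) (hp : p ≤ 1)
    (hτη : (1 - δ) * η ≤ τ) (hr : (1 - δ) ^ 2 * η ^ p ≤ τ / D)
    (hτ : τ * #(piFinset A) = #F) (hd : (#(G.interedges (A a) (A b)) : ℝ) ≤ D * #(A a) * #(A b))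
    (hne : ∀ w, (A w).Nonempty) (hAc : ∀ w, c * n ≤ #(A w))
    (hnum : 200 / (δ * η * c) * (⌈2 / 5 * Real.log n / L⌉₊ : ℝ) ^ 2 ≤
      n * (η ^ (11 / 5 : ℝ)) ^ ⌈2 / 5 * Real.log n / L⌉₊) :
    (H.blowup ⌈η ^ p / (5 * L) * Real.log n⌉₊).IsContained G := by
  set k := Fintype.card W with hk
  have hlogn : 0 < Real.log n := Real.log_pos (by exact_mod_cast hn)
  have hτ₀ : 0 < τ := (mul_pos (by linarith) hη₀).trans_le hτη
  have hδk' : 19 / 20 ≤ (1 - δ) ^ k := hδk.trans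
    (pow_le_pow_of_le_one (by linarith) (by linarith) (by omega))
  set M := ⌈2 / 5 * Real.log n / L⌉₊ with hM
  have hMge : 2 / 5 * Real.log n / L ≤ M := Nat.le_ceil _
  have hM1 : 1 ≤ M := Nat.ceil_pos.2 (by positivity)
  have hM1' : (1 : ℝ) ≤ M := by exact_mod_cast hM1
  set q : ℝ := η ^ (11 / 5 : ℝ) with hq
  have hq₀ : 0 < q := by positivity
  have hqη : q ≤ 8 / 25 * η := rpow_le_of_lt_exp_neg_one hη₀ hη₁
  have hη1 : η < 1 := hη₁.trans_le (Real.exp_le_one_iff.2 (by norm_num))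
  have hδη : δ * η ≤ 1 / 60 * η := by gcongr
  have hqτ : q ≤ τ / 3 := by linarith
  have hηp : η ≤ η ^ p := Real.self_le_rpow_of_le_one hη₀.le hη1.le hp
  have hrη : η / 4 ≤ τ / D := by
    refine le_trans ?_ hr
    have : (1 : ℝ) / 4 ≤ (1 - δ) ^ 2 := by nlinarith
    calc η / 4 = 1 / 4 * η := by ring
      _ ≤ _ := by gcongr
  have hnum' : (M : ℝ) ^ 2 ≤ δ * η * c / 200 * (n * q ^ M) := by
    calc (M : ℝ) ^ 2 = δ * η * c / 200 * (200 / (δ * η * c) * (M : ℝ) ^ 2) := by field_simp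
      _ ≤ _ := by gcongr
  refine blowup_isContained_of_box hA hFA hF hab hτ₀ hD₀ hδ₀ (by linarith) hτ hd hne hM1
    (fun w => ?_) (fun w => ?_) ?_
  · calc (M : ℝ) ^ 2 ≤ _ := hnum'
      _ ≤ 1 * η * c / 120 * (n * q ^ M) := by gcongr <;> linarith
      _ = η / 4 / 30 * q ^ M * (c * n) := by ring
      _ ≤ _ := by gcongr; exact hAc w
  · have hq2 : 2 ^ M * q ^ M ≤ 1 := by
      rw [← mul_pow]; exact pow_le_one₀ (by positivity) (by linarith)
    calc (M : ℝ) ^ 2 * 2 ^ M ≤ δ * η * c / 200 * (n * q ^ M) * 2 ^ M := by gcongr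
      _ = δ * η * c / 200 * n * (2 ^ M * q ^ M) := by ring
      _ ≤ δ * η * c / 200 * n * 1 := by gcongr
      _ ≤ δ * (19 / 20 * (3 / 5 * (η / 4) * 1)) * (c * n) := by
        have : 0 ≤ δ * η * c * n := by positivity
        linarith
      _ ≤ _ := by gcongr; exact hAc w
  · have h19 : 0 < (1 - δ) := by linarith
    calc η ^ p / (5 * L) * Real.log n = 1 / 5 * (η ^ p * (Real.log n / L)) := by
          field_simp
      -- The final slack: 19/20 · 6/25 = 57/250 exceeds 1/5.
      _ ≤ 19 / 20 * (3 / 5 * (2 / 5)) * (η ^ p * (Real.log n / L)) := by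
          gcongr; norm_num
      _ ≤ (1 - δ) ^ (k + 2) * (3 / 5 * (2 / 5)) * (η ^ p * (Real.log n / L)) := by
          gcongr
      _ = (1 - δ) ^ k * (3 / 5 * ((1 - δ) ^ 2 * η ^ p) *
            (2 / 5 * Real.log n / L)) := by ring
      _ ≤ _ := by gcongr
end

open scoped Classical in
theorem mainTheorem2 {W : Type*} [Fintype W] (H : SimpleGraph W) (hH : H.edgeSet.Nonempty)
    (η lam : ℝ) (hη₀ : 0 < η) (hη₁ : η < Real.exp (-1))
    (hlam : lam = η ^ (1 - 1 / (H.edgeSet.ncard : ℝ)) / (5 * Real.log (1 / η))) :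
    ∃ N : ℕ, ∀ n : ℕ, N ≤ n →
      ∀ (V : Type*) [Fintype V] (G : SimpleGraph V), Fintype.card V = n →
        η * (n : ℝ) ^ Fintype.card W ≤ (G.labelledCopyCount H : ℝ) →
          (H.blowup ⌈lam * Real.log (n : ℝ)⌉₊).IsContained G := by
  have : Nonempty W := by
    obtain ⟨e, he⟩ := hH
    induction e with | _ a b => exact ⟨a⟩
  set k := Fintype.card W with hk
  have hk1 : (1 : ℝ) ≤ k := by exact_mod_cast Fintype.card_pos
  set m := H.edgeSet.ncard with hm
  have hm0 : 0 < m := (Set.ncard_pos (Set.toFinite _)).2 hH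
  have hm1 : (1 : ℝ) ≤ m := by exact_mod_cast hm0
  set L := Real.log (1 / η) with hL
  have hL1 : 1 < L := by
    have := Real.log_lt_log hη₀ hη₁
    rw [Real.log_exp] at this
    rw [hL, one_div, Real.log_inv]; linarith
  -- By Bernoulli (1-δ)^(k+2) ≥ 19/20: `k` factors for the extension steps, two for comparing τ/D
  -- with the power of η.
  set δ : ℝ := 1 / (20 * (k + 2)) with hδ
  have hδ₀ : 0 < δ := by positivity
  have hδk : (k + 2) * δ = 1 / 20 := by rw [hδ]; field_simp
  have hδ₁ : δ ≤ 1 / 60 := by nlinarith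
  have hpow : 19 / 20 ≤ (1 - δ) ^ (k + 2) := by
    have := one_add_mul_le_pow (by linarith : -2 ≤ -δ) (k + 2)
    push_cast at this
    rw [← sub_eq_add_neg] at this
    linarith
  -- The two terms of the denominator serve the partition (8k²ε ≤ δη) and the counting lemma (mε ≤
  -- δη/2 ≤ δτ).
  set ε : ℝ := δ * η / (8 * k ^ 2 + 2 * m) with hε
  have hε₀ : 0 < ε := by positivity
  have hε' : (8 * k ^ 2 + 2 * m) * ε = δ * η := by rw [hε]; field_simp
  obtain ⟨c, N, hc, hN⟩ := exists_uniform_box (W := W) (γ := δ * η) (η := η) hε₀ (by positivity)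
    (by nlinarith) (by rw [← hk]; nlinarith)
  have hev := (eventually_sq_ceil_log_le hη₀ hη₁ (C := 200 / (δ * η * c)) (by positivity))
  obtain ⟨N', hN'⟩ := Filter.eventually_atTop.1 hev
  refine ⟨max 2 (max N N'), fun n hn V _ G hV hcount => ?_⟩
  have hn2 : 2 ≤ n := (le_max_left _ _).trans hn
  have hnum := hN' n ((le_max_right _ _).trans ((le_max_right _ _).trans hn))
  subst hV
  set n := Fintype.card V with hn'
  obtain ⟨A, hAd, hAu, hAne, hAc, hAF⟩ := hN V ((le_max_left _ _).trans ((le_max_right _ _).trans hn))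
    G {x : W → V | ∀ e ∈ H.edgeFinset, e.map x ∈ G.edgeSet}
    (hcount.trans (by exact_mod_cast labelledCopyCount_le_card H G))
  set F := boxCopies G A H.edgeFinset with hF
  have hFeq : ({x ∈ Fintype.piFinset A | x ∈ ({x : W → V | ∀ e ∈ H.edgeFinset,
      e.map x ∈ G.edgeSet} : Finset (W → V))} : Finset (W → V)) = F := by
    ext x; simp [hF, boxCopies]
  rw [hFeq] at hAF
  have hpi : (0 : ℝ) < (Fintype.piFinset A).card := by
    choose x hx using hAne
    exact_mod_cast Finset.card_pos.2 ⟨x, by simpa using hx⟩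
  set τ : ℝ := F.card / (Fintype.piFinset A).card with hτ
  have hτpi : τ * (Fintype.piFinset A).card = F.card := div_mul_cancel₀ _ hpi.ne'
  have hτη : (1 - δ) * η ≤ τ := by
    rw [hτ, le_div_iff₀ hpi]; linarith
  have hτ₀ : 0 < τ := (mul_pos (by linarith) hη₀).trans_le hτη
  have hmε : m * ε ≤ δ * τ := by
    have h1 : 0 ≤ (k : ℝ) ^ 2 * ε := by positivity
    have h2 : δ * ((1 - δ) * η) ≤ δ * τ := by gcongr
    have h3 : δ * η * δ ≤ δ * η * (1 / 60) := by gcongr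
    have h4 : 0 < δ * η := by positivity
    linarith
  obtain ⟨a, b, hab, hd⟩ := exists_adj_card_interedges_le hH hε₀.le hδ₀.le hτ₀ hAne hAu hτpi hmε
  rw [hlam]
  refine blowup_isContained_of_large_box hAd (Finset.filter_subset _ _) ?_ hab hη₀ hη₁
    (by linarith) (by omega) hc (by positivity) hδ₀ hδ₁ hpow ?_ hτη
    (div_rpow_ge hδ₀.le (by linarith) hη₀ hτη hm1) hτpi hd hAne hAc hnum
  · intro x hx u v huv
    exact (Finset.mem_filter.1 hx).2 s(u, v) (SimpleGraph.mem_edgeFinset.2 huv)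
  · have : 0 ≤ 1 / (m : ℝ) := by positivity
    linarith
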